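/- Let $n\in\mathbb N$ and let $F:\mathbb R^n\times\mathbb R_{\ge 0}\to 2^{\mathbb R^n}$ be a set-valued map. Intervals are nonempty and contained in $\mathbb R_{\ge 0}$, and suprema are taken in $[0,\infty]$. A function $g$ is *locally absolutely continuous* on an interval $I$ if it is absolutely continuous on each compact interval contained in $I$. For a set $S\subseteq I$, $g$ is *AC$_*$* on $S$ if for each $\varepsilon>0$ there is $\delta>0$ such that $\sum_{i=1}^m\sup_{a,b\in[a_i,b_i]}\|g(b)-g(a)\|<\varepsilon$ for each finite collection of non-overlapping intervals $[a_i,b_i]$ with $a_i,b_i\in S$ and $\sum_{i=1}^m|b_i-a_i|<\delta$; and $g$ is *ACG$_*$* on $I$ if it is continuous on $I$ and $I$ is a countable union of sets on each of which $g$ is AC$_*$. A function $x:I\to\mathbb R^n$ on an interval $I$ is a *classical* (respectively *generalized*) *solution* of the differential inclusion $\dot x\in F(x,t)$ if it is locally absolutely continuous (respectively ACG$_*$) on $I$ and, for almost every $t\in I$, $x$ is differentiable at $t$ with $\dot x(t)\in F(x(t),t)$. A classical (generalized) solution $x:I\to\mathbb R^n$ is *maximal* if there is no classical (generalized) solution $\bar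 x:\bar I\to\mathbb R^n$ with $\bar I\cap I\neq\emptyset$, $\sup\bar I>\sup I$ and $x(t)=\bar x(t)$ for all $t\in I\cap\bar I$. **Lemma.** Let $\mathcal D\subset\mathbb R_{\ge 0}$ have no cluster (accumulation) points in $\mathbb R$, and suppose that $F$ is locally bounded on $\mathcal E=\mathbb R^n\times(\mathbb R_{\ge 0}\setminus\mathcal D)$, i.e. every point of $\mathcal E$ has a neighborhood $U$ in $\mathcal E$ for which $\bigcup_{(z,t)\in U}F(z,t)$ is bounded. Let $x:I\to\mathbb R^n$ be a maximal generalized solution of $\dot x\in F(x,t)$. If $I$ is bounded above or $\mathcal D$ is bounded above (possibly empty), then there is an interval $J\subseteq I$ with $\sup J=\sup I$ such that $x|_J$ is a maximal classical solution of $\dot x\in F(x,t)$; moreover, $J$ has more than one point if $I$ does. -/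

import Mathlib

open Set Filter Topology MeasureTheory

/-- A function is represented by a map on all of `ℝ`; every notion below that refers to an
interval `I` depends only on the values of the map on `I`. A time interval is a nonempty,
possibly degenerate or unbounded, interval contained in `[0, ∞)`. -/
def IsTimeInterval (I : Set ℝ) : Prop :=
  I.OrdConnected ∧ I.Nonempty ∧ I ⊆ Ici 0

/-- The supremum of a set of reals in the extended real line. -/
noncomputable def extSup (S : Set ℝ) : EReal :=
  sSup ((fun t : ℝ => (t : EReal)) '' S)

/-- Local absolute continuity on an interval: absolute continuity on each compact subinterval. -/
def IsLAC {n : ℕ} (g : ℝ → EuclideanSpace ℝ (Fin n)) (I : Set ℝ) : Prop :=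
  ∀ a b : ℝ, a ≤ b → Icc a b ⊆ I → AbsolutelyContinuousOnInterval g a b

/-- Absolute continuity in the restricted sense (AC⋆) on a set `S`. The oscillation
`sup_{s,t ∈ [a i, b i]} ‖g t - g s‖` is the diameter of the image of `[a i, b i]`, taken in
`[0, ∞]` so that an infinite oscillation is not mistaken for a finite one. -/
def IsACStar {n : ℕ} (g : ℝ → EuclideanSpace ℝ (Fin n)) (S : Set ℝ) : Prop :=
  ∀ ε : ℝ, 0 < ε → ∃ δ : ℝ, 0 < δ ∧
    ∀ (m : ℕ) (a b : Fin m → ℝ),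
      (∀ i, a i ∈ S ∧ b i ∈ S ∧ a i ≤ b i) →
      (Pairwise fun i j => Disjoint (Ioo (a i) (b i)) (Ioo (a j) (b j))) →
      ∑ i, (b i - a i) < δ →
      ∑ i, Metric.ediam (g '' Icc (a i) (b i)) < ENNReal.ofReal ε

/-- Generalized absolute continuity in the restricted sense (ACG⋆) on a set `S`. -/
def IsACGStar {n : ℕ} (g : ℝ → EuclideanSpace ℝ (Fin n)) (S : Set ℝ) : Prop :=
  ContinuousOn g S ∧ ∃ P : ℕ → Set ℝ, S = ⋃ k, P k ∧ ∀ k, IsACStar g (P k)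

/-- The inclusion `ẋ ∈ F(x, t)` holds almost everywhere on `I`. -/
def SatisfiesInclusion {n : ℕ}
    (F : EuclideanSpace ℝ (Fin n) → ℝ → Set (EuclideanSpace ℝ (Fin n)))
    (I : Set ℝ) (x : ℝ → EuclideanSpace ℝ (Fin n)) : Prop :=
  ∀ᵐ t ∂(volume.restrict I), ∃ v ∈ F (x t) t, HasDerivWithinAt x v I t

/-- `x` is a classical solution of `ẋ ∈ F(x, t)` on `I`. -/
def IsClassicalSolution {n : ℕ}
    (F : EuclideanSpace ℝ (Fin n) → ℝ → Set (EuclideanSpace ℝ (Fin n)))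
    (I : Set ℝ) (x : ℝ → EuclideanSpace ℝ (Fin n)) : Prop :=
  IsTimeInterval I ∧ IsLAC x I ∧ SatisfiesInclusion F I x

/-- `x` is a generalized solution of `ẋ ∈ F(x, t)` on `I`. -/
def IsGeneralizedSolution {n : ℕ}
    (F : EuclideanSpace ℝ (Fin n) → ℝ → Set (EuclideanSpace ℝ (Fin n)))
    (I : Set ℝ) (x : ℝ → EuclideanSpace ℝ (Fin n)) : Prop :=
  IsTimeInterval I ∧ IsACGStar x I ∧ SatisfiesInclusion F I x

/-- With respect to a notion `Sol` of solution (classical or generalized), `x` on `I` is a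
maximal solution: no solution of the same kind, on an interval that meets `I` and has a larger
supremum, agrees with `x` on the common domain. -/
def IsMaximalSolution {n : ℕ} (Sol : Set ℝ → (ℝ → EuclideanSpace ℝ (Fin n)) → Prop)
    (I : Set ℝ) (x : ℝ → EuclideanSpace ℝ (Fin n)) : Prop :=
  Sol I x ∧ ¬ ∃ (I' : Set ℝ) (x' : ℝ → EuclideanSpace ℝ (Fin n)),
    Sol I' x' ∧ (I' ∩ I).Nonempty ∧ extSup I < extSup I' ∧ EqOn x x' (I ∩ I')

/-- The set-valued map `F` is locally bounded on the set `E` of pairs `(z, t)`. -/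
def LocallyBoundedOn {n : ℕ}
    (F : EuclideanSpace ℝ (Fin n) → ℝ → Set (EuclideanSpace ℝ (Fin n)))
    (E : Set (EuclideanSpace ℝ (Fin n) × ℝ)) : Prop :=
  ∀ p ∈ E, ∃ Q : ℝ, ∀ᶠ q in 𝓝[E] p, ∀ v ∈ F q.1 q.2, ‖v‖ ≤ Q

/-!
A continuous curve on an interval is `K`-Lipschitz as soon as it maps null sets to sets of length
zero (Lusin's condition) and has a derivative of norm at most `K` at almost every time: the distance
between two of its points is at most the length of the arc joining them, and only the times where
the derivative is controlled contribute to that length. An ACG⋆ curve satisfies Lusin's condition: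
cover a null set by an open set of small measure and sum the oscillations over its components. As
`F` is locally bounded away from `D`, a generalized solution is therefore locally Lipschitz, hence
classical, on every interval that avoids `D`, in particular on a terminal piece `J` of `I`.

Conversely, a classical extension beyond `J` is a generalized solution on compact intervals, since
absolute continuity there implies ACG⋆. It agrees with `x` on `J`, and by continuity also at the
last time of `I`, if there is one; so it would contradict the maximality of `x`.
-/

open scoped NNReal ENNReal Function

section LusinCondition

variable {X : Type*}

/-- Lusin's condition (N) on a set `s`: the curve `g` maps null sets of times in `s` to sets of zero
length. Length is the one-dimensional Hausdorff measure, so that curves in any metric space are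
covered. -/
def LusinCondition [EMetricSpace X] [MeasurableSpace X] [BorelSpace X] (g : ℝ → X) (s : Set ℝ) :
    Prop :=
  ∀ N ⊆ s, volume N = 0 → μH[1] (g '' N) = 0

theorem hausdorffMeasure_eq_zero_of_forall_exists_cover [EMetricSpace X] [MeasurableSpace X]
    [BorelSpace X] {d : ℝ} (hd : 0 < d) {s : Set X}
    (h : ∀ ε : ℝ≥0∞, ε ≠ 0 → ∃ (ι : Type) (_ : Countable ι) (t : ι → Set X),
      s ⊆ ⋃ i, t i ∧ ∑' i, Metric.ediam (t i) ^ d ≤ ε) :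
    μH[d] s = 0 := by
  choose ι hι t hst ht using fun k : ℕ => h (k : ℝ≥0∞)⁻¹ (by simp)
  have hlim : Tendsto (fun k : ℕ => (k : ℝ≥0∞)⁻¹) atTop (𝓝 0) := ENNReal.tendsto_inv_nat_nhds_zero
  have hdiam : ∀ k i, Metric.ediam (t k i) ≤ ((k : ℝ≥0∞)⁻¹) ^ d⁻¹ := fun k i =>
    (ENNReal.le_rpow_inv_iff hd).2 ((ENNReal.le_tsum i).trans (ht k))
  have hdiam_lim : Tendsto (fun k : ℕ => ((k : ℝ≥0∞)⁻¹) ^ d⁻¹) atTop (𝓝 0) := by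
    have hcont : Tendsto (fun y : ℝ≥0∞ => y ^ d⁻¹) (𝓝 0) (𝓝 (0 ^ d⁻¹)) :=
      ENNReal.continuous_rpow_const.tendsto 0
    rw [ENNReal.zero_rpow_of_pos (inv_pos.2 hd)] at hcont
    exact hcont.comp hlim
  refine le_antisymm ?_ zero_le
  calc μH[d] s ≤ liminf (fun k => ∑' i, Metric.ediam (t k i) ^ d) atTop :=
        Measure.hausdorffMeasure_le_liminf_tsum d s _ hdiam_lim t (.of_forall hdiam)
          (.of_forall hst)
    _ ≤ liminf (fun k : ℕ => (k : ℝ≥0∞)⁻¹) atTop := liminf_le_liminf (.of_forall ht)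
    _ = 0 := hlim.liminf_eq

theorem edist_le_hausdorffMeasure_of_isPreconnected [MetricSpace X] [MeasurableSpace X]
    [BorelSpace X] {s : Set X} (hs : IsPreconnected s) {x y : X} (hx : x ∈ s) (hy : y ∈ s) :
    edist x y ≤ μH[1] s := by
  have hlip : LipschitzWith 1 (dist x) := LipschitzWith.dist_right x
  have hsub : Icc (dist x x) (dist x y) ⊆ dist x '' s :=
    (hs.image _ hlip.continuous.continuousOn).ordConnected.out (mem_image_of_mem _ hx)
      (mem_image_of_mem _ hy)
  calc edist x y = volume (Icc (dist x x) (dist x y)) := by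
        rw [Real.volume_Icc, dist_self, sub_zero, edist_dist]
    _ ≤ μH[1] (dist x '' s) := by
        rw [hausdorffMeasure_real]
        exact measure_mono hsub
    _ ≤ μH[1] s := by simpa using hlip.hausdorffMeasure_image_le zero_le_one s

theorem hausdorffMeasure_image_le_of_lipschitzOnWith_inter {Y : Type*} [EMetricSpace X]
    [MeasurableSpace X] [BorelSpace X] [EMetricSpace Y] [MeasurableSpace Y] [BorelSpace Y]
    {f : X → Y} {s : Set X} {t : ℕ → Set X} {K : ℝ≥0} {d : ℝ} (hd : 0 ≤ d)
    (htd : Pairwise (Disjoint on t)) (htm : ∀ k, MeasurableSet (t k)) (hst : s ⊆ ⋃ k, t k)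
    (hf : ∀ k, LipschitzOnWith K f (s ∩ t k)) :
    μH[d] (f '' s) ≤ (K : ℝ≥0∞) ^ d * μH[d] s := by
  have himage : f '' s = ⋃ k, f '' (s ∩ t k) := by
    rw [← image_iUnion, ← inter_iUnion, inter_eq_left.2 hst]
  calc μH[d] (f '' s) ≤ ∑' k, μH[d] (f '' (s ∩ t k)) := himage ▸ measure_iUnion_le _
    _ ≤ ∑' k, (K : ℝ≥0∞) ^ d * μH[d] (s ∩ t k) :=
        ENNReal.tsum_le_tsum fun k => (hf k).hausdorffMeasure_image_le hd
    _ = (K : ℝ≥0∞) ^ d * μH[d].restrict s (⋃ k, t k) := by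
        simp only [ENNReal.tsum_mul_left, measure_iUnion htd htm, Measure.restrict_apply (htm _),
          inter_comm]
    _ ≤ (K : ℝ≥0∞) ^ d * μH[d] s := by
        gcongr _ * ?_
        exact (measure_mono (subset_univ _)).trans_eq (Measure.restrict_apply_univ s)

theorem hausdorffMeasure_image_le_of_hasFDerivWithinAt {E F : Type*} [NormedAddCommGroup E]
    [NormedSpace ℝ E] [FiniteDimensional ℝ E] [MeasurableSpace E] [BorelSpace E]
    [NormedAddCommGroup F] [NormedSpace ℝ F] [SecondCountableTopology F] [MeasurableSpace F]
    [BorelSpace F] {f : E → F} {f' : E → E →L[ℝ] F} {s : Set E} {K : ℝ≥0} {d : ℝ} (hd : 0 ≤ d)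
    (hs : μH[d] s ≠ ∞) (hf : ∀ x ∈ s, HasFDerivWithinAt f (f' x) s x) (hK : ∀ x ∈ s, ‖f' x‖₊ ≤ K) :
    μH[d] (f '' s) ≤ (K : ℝ≥0∞) ^ d * μH[d] s := by
  rcases s.eq_empty_or_nonempty with rfl | hne
  · simp
  have hpos : ∀ r : ℝ≥0, r ≠ 0 → μH[d] (f '' s) ≤ ((K + r : ℝ≥0) : ℝ≥0∞) ^ d * μH[d] s := by
    intro r hr
    obtain ⟨t, A, htd, htm, hst, hA, hAf'⟩ :=
      exists_partition_approximatesLinearOn_of_hasFDerivWithinAt f s f' hf (fun _ => r) fun _ => hr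
    refine hausdorffMeasure_image_le_of_lipschitzOnWith_inter hd htd htm hst fun k => ?_
    obtain ⟨y, hy, hAy⟩ := hAf' hne k
    exact (lipschitzOnWith_iff_restrict.2 (hA k).lipschitz).weaken
      (add_le_add_left (hAy ▸ hK y hy) r)
  have hcont : Continuous fun r : ℝ≥0 => ((K + r : ℝ≥0) : ℝ≥0∞) ^ d :=
    ENNReal.continuous_rpow_const.comp (by fun_prop)
  have hlim : Tendsto (fun r : ℝ≥0 => ((K + r : ℝ≥0) : ℝ≥0∞) ^ d * μH[d] s) (𝓝[>] 0)
      (𝓝 (((K + 0 : ℝ≥0) : ℝ≥0∞) ^ d * μH[d] s)) :=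
    ENNReal.Tendsto.mul_const ((hcont.tendsto 0).mono_left nhdsWithin_le_nhds) (Or.inr hs)
  rw [add_zero] at hlim
  exact ge_of_tendsto hlim (eventually_mem_nhdsWithin.mono fun r hr => hpos r (ne_of_gt hr))

theorem lipschitzOnWith_of_lusinCondition {E : Type*} [NormedAddCommGroup E] [NormedSpace ℝ E]
    [SecondCountableTopology E] [MeasurableSpace E] [BorelSpace E] {g : ℝ → E} {s : Set ℝ} {K : ℝ≥0}
    (hs : s.OrdConnected) (hcont : ContinuousOn g s) (hN : LusinCondition g s)
    (hderiv : ∀ᵐ t ∂volume.restrict s, ∃ v, ‖v‖₊ ≤ K ∧ HasDerivWithinAt g v s t) :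
    LipschitzOnWith K g s := by
  intro a ha b hb
  have hab : uIcc a b ⊆ s := hs.uIcc_subset ha hb
  let G : Set ℝ := {t | ∃ v, ‖v‖₊ ≤ K ∧ HasDerivWithinAt g v s t}
  have hbad : volume (uIcc a b \ G) = 0 := by
    rw [ae_restrict_iff' hs.measurableSet, ae_iff] at hderiv
    refine measure_mono_null (fun t ht => ?_) hderiv
    exact fun htG => ht.2 (htG (hab ht.1))
  have hgood : μH[1] (g '' (uIcc a b ∩ G)) ≤ K * volume (uIcc a b) := by
    choose! v hvK hv using fun t (ht : t ∈ G) => ht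
    have hle := hausdorffMeasure_image_le_of_hasFDerivWithinAt (f := g) (s := uIcc a b ∩ G) (K := K)
      (f' := fun t => ContinuousLinearMap.toSpanSingleton ℝ (v t)) zero_le_one
      (by
        rw [hausdorffMeasure_real]
        exact ((measure_mono inter_subset_left).trans_lt isCompact_uIcc.measure_lt_top).ne)
      (fun t ht => ((hv t ht.2).mono (inter_subset_left.trans hab)).hasFDerivWithinAt)
      fun t ht => by simpa using hvK t ht.2
    rw [hausdorffMeasure_real, ENNReal.rpow_one] at hle
    exact hle.trans (by gcongr; exact inter_subset_left)
  calc edist (g a) (g b) ≤ μH[1] (g '' uIcc a b) :=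
        edist_le_hausdorffMeasure_of_isPreconnected
          (isPreconnected_uIcc.image g (hcont.mono hab)) (mem_image_of_mem g left_mem_uIcc)
          (mem_image_of_mem g right_mem_uIcc)
    _ ≤ μH[1] (g '' (uIcc a b ∩ G)) + μH[1] (g '' (uIcc a b \ G)) := by
        rw [← inter_union_sdiff (uIcc a b) G, image_union, inter_union_sdiff]
        exact measure_union_le _ _
    _ ≤ K * volume (uIcc a b) + 0 := by
        gcongr
        exact (hN _ (sdiff_subset.trans hab) hbad).le
    _ = K * edist a b := by
        rw [add_zero, uIcc, Real.volume_Icc, max_sub_min_eq_abs, edist_dist, dist_comm,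
          Real.dist_eq]

end LusinCondition

section ACStar

theorem ediam_image_le_of_forall_le {α X : Type*} [LinearOrder α] [PseudoEMetricSpace X]
    {f : α → X} {s : Set α} {r : ℝ≥0∞} (h : ∀ a ∈ s, ∀ b ∈ s, a ≤ b → edist (f a) (f b) ≤ r) :
    Metric.ediam (f '' s) ≤ r := by
  refine Metric.ediam_image_le_iff.2 fun a ha b hb => ?_
  rcases le_total a b with hab | hba
  · exact h a ha b hb hab
  · exact edist_comm (f a) (f b) ▸ h b hb a ha hba

theorem exists_ediam_image_le_two_mul_edist {α X : Type*} [LinearOrder α] [PseudoEMetricSpace X]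
    {f : α → X} {s : Set α} (hs : s.Nonempty) (hfin : Metric.ediam (f '' s) ≠ ∞) :
    ∃ a ∈ s, ∃ b ∈ s, a ≤ b ∧ Metric.ediam (f '' s) ≤ 2 * edist (f a) (f b) := by
  by_contra! hlt
  obtain ⟨c, hc⟩ := hs
  have hpos : 0 < Metric.ediam (f '' s) := by simpa using hlt c hc c hc le_rfl
  refine (ENNReal.half_lt_self hpos.ne' hfin).not_ge ?_
  refine ediam_image_le_of_forall_le fun a ha b hb hab => ?_
  rw [ENNReal.le_div_iff_mul_le (by simp) (by simp), mul_comm]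
  exact (hlt a ha b hb hab).le

theorem edist_le_ediam_image_Icc {α X : Type*} [Preorder α] [PseudoEMetricSpace X] {f : α → X}
    {a b : α} (hab : a ≤ b) : edist (f a) (f b) ≤ Metric.ediam (f '' Icc a b) :=
  Metric.edist_le_ediam_of_mem (mem_image_of_mem f (left_mem_Icc.2 hab))
    (mem_image_of_mem f (right_mem_Icc.2 hab))

variable {n : ℕ} {g : ℝ → EuclideanSpace ℝ (Fin n)} {S T : Set ℝ}

theorem IsACStar.mono (h : IsACStar g S) (hTS : T ⊆ S) : IsACStar g T := by
  intro ε hε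
  obtain ⟨δ, hδ, hsum⟩ := h ε hε
  exact ⟨δ, hδ, fun m a b hab => hsum m a b fun i => ⟨hTS (hab i).1, hTS (hab i).2.1, (hab i).2.2⟩⟩

theorem IsACGStar.mono (h : IsACGStar g S) (hTS : T ⊆ S) : IsACGStar g T := by
  obtain ⟨hcont, P, rfl, hP⟩ := h
  refine ⟨hcont.mono hTS, fun k => T ∩ P k, ?_, fun k => (hP k).mono inter_subset_right⟩
  rw [← inter_iUnion, inter_eq_left.2 hTS]

theorem IsACStar.exists_tsum_ediam_image_Icc_le (h : IsACStar g S) {ε : ℝ≥0∞} (hε : ε ≠ 0) :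
    ∃ δ : ℝ≥0∞, δ ≠ 0 ∧ ∀ {ι : Type} (a b : ι → ℝ), (∀ i, a i ∈ S ∧ b i ∈ S ∧ a i ≤ b i) →
      Pairwise (Disjoint on fun i => Ioo (a i) (b i)) → volume (⋃ i, Ioo (a i) (b i)) < δ →
      ∑' i, Metric.ediam (g '' Icc (a i) (b i)) ≤ ε := by
  obtain ⟨ε', -, hε'ε⟩ := ENNReal.lt_iff_exists_real_btwn.1 (pos_iff_ne_zero.2 hε)
  obtain ⟨δ, hδ, hsum⟩ := h ε' (ENNReal.ofReal_pos.1 hε'ε.1)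
  refine ⟨ENNReal.ofReal δ, (ENNReal.ofReal_pos.2 hδ).ne', fun {ι} a b hab hdisj hvol => ?_⟩
  rw [ENNReal.tsum_eq_iSup_sum]
  refine iSup_le fun A => ?_
  have hlen : ∑ i ∈ A, (b i - a i) < δ := by
    rw [← ENNReal.ofReal_lt_ofReal_iff hδ]
    refine lt_of_le_of_lt ?_ hvol
    calc ENNReal.ofReal (∑ i ∈ A, (b i - a i)) = ∑ i ∈ A, volume (Ioo (a i) (b i)) := by
          rw [ENNReal.ofReal_sum_of_nonneg fun i _ => sub_nonneg.2 (hab i).2.2]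
          simp only [Real.volume_Ioo]
      _ = volume (⋃ i ∈ A, Ioo (a i) (b i)) :=
          (measure_biUnion_finset (hdisj.pairwiseDisjoint _) fun i _ => measurableSet_Ioo).symm
      _ ≤ volume (⋃ i, Ioo (a i) (b i)) := measure_mono (iUnion₂_subset_iUnion _ _)
  let e := A.equivFin.symm
  have he : Function.Injective fun k => (e k : ι) := Subtype.val_injective.comp e.injective
  rw [← A.sum_coe_sort, ← e.sum_comp] at hlen ⊢
  exact (hsum _ (fun k => a (e k)) (fun k => b (e k)) (fun k => hab _)
    (hdisj.comp_of_injective he) hlen).le.trans hε'ε.2.le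

theorem IsACStar.exists_tsum_ediam_image_inter_le (h : IsACStar g S) {ε : ℝ≥0∞} (hε : ε ≠ 0) :
    ∃ δ : ℝ≥0∞, δ ≠ 0 ∧ ∀ {ι : Type} (c : ι → Set ℝ), (∀ i, (c i).OrdConnected) →
      (∀ i, (S ∩ c i).Nonempty) → Pairwise (Disjoint on c) → volume (⋃ i, c i) < δ →
      ∑' i, Metric.ediam (g '' (S ∩ c i)) ≤ ε := by
  rcases eq_or_ne ε ∞ with rfl | hε_top
  · exact ⟨1, one_ne_zero, fun _ _ _ _ _ => le_top⟩
  obtain ⟨δ, hδ, hsum⟩ := h.exists_tsum_ediam_image_Icc_le (ENNReal.half_pos hε).ne'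
  refine ⟨δ, hδ, fun {ι} c hc hne hdisj hvol => ?_⟩
  have hIoo : ∀ i, ∀ a ∈ S ∩ c i, ∀ b ∈ S ∩ c i, Ioo a b ⊆ c i := fun i a ha b hb =>
    Ioo_subset_Icc_self.trans ((hc i).out ha.2 hb.2)
  have hfin : ∀ i, Metric.ediam (g '' (S ∩ c i)) ≠ ∞ := by
    refine fun i => ne_top_of_le_ne_top (ENNReal.div_ne_top hε_top two_ne_zero) ?_
    refine ediam_image_le_of_forall_le fun a ha b hb hab => ?_
    have hvol' : volume (⋃ _ : Unit, Ioo a b) < δ :=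
      (measure_mono (iUnion_subset fun _ => (hIoo i a ha b hb).trans (subset_iUnion c i))).trans_lt
        hvol
    simpa using (edist_le_ediam_image_Icc hab).trans ((ENNReal.le_tsum ()).trans
      (hsum (fun _ => a) (fun _ => b) (fun _ => ⟨ha.1, hb.1, hab⟩) Subsingleton.pairwise hvol'))
  choose a ha b hb hab hdiam using fun i => exists_ediam_image_le_two_mul_edist (hne i) (hfin i)
  have hIoo_sub : ∀ i, Ioo (a i) (b i) ⊆ c i := fun i => hIoo i _ (ha i) _ (hb i)
  calc ∑' i, Metric.ediam (g '' (S ∩ c i))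
      ≤ ∑' i, 2 * Metric.ediam (g '' Icc (a i) (b i)) := by
        gcongr with i
        exact (hdiam i).trans (by gcongr; exact edist_le_ediam_image_Icc (hab i))
    _ = 2 * ∑' i, Metric.ediam (g '' Icc (a i) (b i)) := ENNReal.tsum_mul_left
    _ ≤ 2 * (ε / 2) := by
        gcongr
        exact hsum a b (fun i => ⟨(ha i).1, (hb i).1, hab i⟩)
          (hdisj.mono fun i j hij => hij.mono (hIoo_sub i) (hIoo_sub j))
          ((measure_mono (iUnion_mono hIoo_sub)).trans_lt hvol)
    _ = ε := ENNReal.mul_div_cancel two_ne_zero ENNReal.ofNat_ne_top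

theorem exists_countable_pairwiseDisjoint_isConnected_sUnion_eq {X : Type*} [TopologicalSpace X]
    [LocallyConnectedSpace X] [TopologicalSpace.SeparableSpace X] {U : Set X} (hU : IsOpen U) :
    ∃ C : Set (Set X), C.Countable ∧ C.PairwiseDisjoint id ∧ (∀ c ∈ C, IsConnected c) ∧
      ⋃₀ C = U := by
  have hconn : ∀ c ∈ connectedComponentIn U '' U, IsConnected c :=
    forall_mem_image.2 fun y hy => isConnected_connectedComponentIn_iff.2 hy
  have hdisj : (connectedComponentIn U '' U).PairwiseDisjoint id := by
    rintro _ ⟨y, -, rfl⟩ _ ⟨z, -, rfl⟩ hne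
    refine disjoint_left.2 fun w hwy hwz => hne ?_
    exact (connectedComponentIn_eq hwy).trans (connectedComponentIn_eq hwz).symm
  refine ⟨connectedComponentIn U '' U, ?_, hdisj, hconn, ?_⟩
  · exact hdisj.countable_of_isOpen (forall_mem_image.2 fun y _ => hU.connectedComponentIn)
      fun c hc => (hconn c hc).nonempty
  · exact (sUnion_subset (forall_mem_image.2 fun y _ => connectedComponentIn_subset U y)).antisymm
      fun y hy => ⟨_, mem_image_of_mem _ hy, mem_connectedComponentIn hy⟩

theorem IsACStar.lusinCondition (h : IsACStar g S) : LusinCondition g S := by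
  intro N hNS hN
  refine hausdorffMeasure_eq_zero_of_forall_exists_cover one_pos fun ε hε => ?_
  obtain ⟨δ, hδ, hsum⟩ := (h.mono hNS).exists_tsum_ediam_image_inter_le hε
  obtain ⟨U, hNU, hUo, hU⟩ : ∃ U, N ⊆ U ∧ IsOpen U ∧ volume U < δ :=
    N.exists_isOpen_lt_of_lt δ (hN ▸ pos_iff_ne_zero.2 hδ)
  obtain ⟨C, hC, hdisj, hconn, rfl⟩ := exists_countable_pairwiseDisjoint_isConnected_sUnion_eq hUo
  let ι := {c // c ∈ C ∧ (N ∩ c).Nonempty}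
  refine ⟨ι, (hC.mono fun _ => And.left).to_subtype, fun c => g '' (N ∩ c), ?_, ?_⟩
  · rintro _ ⟨y, hy, rfl⟩
    obtain ⟨c, hc, hyc⟩ := hNU hy
    exact mem_iUnion.2 ⟨⟨c, hc, y, hy, hyc⟩, mem_image_of_mem g ⟨hy, hyc⟩⟩
  · simp only [ENNReal.rpow_one]
    exact hsum (fun c : ι => (c : Set ℝ)) (fun c => (hconn c c.2.1).isPreconnected.ordConnected)
      (fun c => c.2.2) (fun c c' hcc' => hdisj c.2.1 c'.2.1 (Subtype.coe_injective.ne hcc'))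
      ((measure_mono (iUnion_subset fun c => subset_sUnion_of_mem c.2.1)).trans_lt hU)

theorem IsACGStar.lusinCondition (h : IsACGStar g S) : LusinCondition g S := by
  obtain ⟨-, P, rfl, hP⟩ := h
  intro N hNS hN
  rw [← inter_eq_left.2 hNS, inter_iUnion, image_iUnion]
  exact measure_iUnion_null fun k =>
    (hP k).lusinCondition _ inter_subset_right (measure_mono_null inter_subset_left hN)

theorem IsACGStar.lipschitzOnWith {K : ℝ≥0} (h : IsACGStar g S) (hS : S.OrdConnected)
    (hderiv : ∀ᵐ t ∂volume.restrict S, ∃ v, ‖v‖₊ ≤ K ∧ HasDerivWithinAt g v S t) :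
    LipschitzOnWith K g S :=
  lipschitzOnWith_of_lusinCondition hS h.1 h.lusinCondition hderiv

theorem exists_forall_sum_dist_lt_of_absolutelyContinuousOnInterval {X : Type*}
    [PseudoMetricSpace X] {f : ℝ → X} {p q : ℝ} (h : AbsolutelyContinuousOnInterval f p q) {ε : ℝ}
    (hε : 0 < ε) :
    ∃ δ > 0, ∀ (m : ℕ) (a b : Fin m → ℝ), (∀ i, a i ∈ uIcc p q ∧ b i ∈ uIcc p q ∧ a i ≤ b i) →
      (Pairwise fun i j => Disjoint (Ioo (a i) (b i)) (Ioo (a j) (b j))) →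
      ∑ i, (b i - a i) < δ → ∑ i, dist (f (a i)) (f (b i)) < ε := by
  obtain ⟨δ, hδ, hsum⟩ := (absolutelyContinuousOnInterval_iff f p q).1 h ε hε
  refine ⟨δ, hδ, fun m a b hab hdisj hlen => ?_⟩
  let E : ℕ → ℝ × ℝ := Function.extend Fin.val (fun i => (a i, b i)) 0
  have hE : ∀ i : Fin m, E i = (a i, b i) := fun i => Fin.val_injective.extend_apply _ _ i
  have hmem : (m, E) ∈ AbsolutelyContinuousOnInterval.disjWithin p q := by
    refine ⟨fun i hi => ?_, fun i hi j hj hij => ?_⟩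
    · lift i to Fin m using Finset.mem_range.1 hi
      simpa only [hE] using ⟨(hab i).1, (hab i).2.1⟩
    · lift i to Fin m using Finset.mem_range.1 hi
      lift j to Fin m using Finset.mem_range.1 hj
      have hij' := hdisj (ne_of_apply_ne _ hij)
      simp only [Function.onFun, hE, uIoc_of_le (hab i).2.2, uIoc_of_le (hab j).2.2]
      rwa [Ioc_disjoint_Ioc, ← Ioo_disjoint_Ioo]
  have hlt := hsum (m, E) hmem
  rw [← Fin.sum_univ_eq_sum_range fun i => dist (E i).1 (E i).2,
    ← Fin.sum_univ_eq_sum_range fun i => dist (f (E i).1) (f (E i).2)] at hlt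
  simp only [hE] at hlt
  refine hlt (lt_of_le_of_lt (Finset.sum_le_sum fun i _ => ?_) hlen)
  rw [dist_comm, Real.dist_eq, abs_of_nonneg (sub_nonneg.2 (hab i).2.2)]

theorem isACStar_of_absolutelyContinuousOnInterval {p q : ℝ}
    (h : AbsolutelyContinuousOnInterval g p q) : IsACStar g (uIcc p q) := by
  intro ε hε
  obtain ⟨δ, hδ, hsum⟩ :=
    exists_forall_sum_dist_lt_of_absolutelyContinuousOnInterval h (half_pos hε)
  refine ⟨δ, hδ, fun m a b hab hdisj hlen => ?_⟩
  have hsub : ∀ i, Icc (a i) (b i) ⊆ uIcc p q := fun i =>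
    ordConnected_uIcc.out (hab i).1 (hab i).2.1
  have hfin : ∀ i, Metric.ediam (g '' Icc (a i) (b i)) ≠ ∞ := fun i =>
    (isCompact_Icc.image_of_continuousOn (h.continuousOn.mono (hsub i))).isBounded.ediam_ne_top
  choose s hs t ht hst hdiam using fun i =>
    exists_ediam_image_le_two_mul_edist (nonempty_Icc.2 (hab i).2.2) (hfin i)
  have hlt : ∑ i, dist (g (s i)) (g (t i)) < ε / 2 := by
    refine hsum m s t (fun i => ⟨hsub i (hs i), hsub i (ht i), hst i⟩) (fun i j hij => ?_)
      (lt_of_le_of_lt (Finset.sum_le_sum fun i _ => sub_le_sub (ht i).2 (hs i).1) hlen)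
    exact (hdisj hij).mono (Ioo_subset_Ioo (hs i).1 (ht i).2) (Ioo_subset_Ioo (hs j).1 (ht j).2)
  calc ∑ i, Metric.ediam (g '' Icc (a i) (b i))
      ≤ ∑ i, 2 * edist (g (s i)) (g (t i)) := Finset.sum_le_sum fun i _ => hdiam i
    _ = 2 * ENNReal.ofReal (∑ i, dist (g (s i)) (g (t i))) := by
        simp only [← Finset.mul_sum, edist_dist,
          ENNReal.ofReal_sum_of_nonneg fun _ _ => dist_nonneg]
    _ < 2 * ENNReal.ofReal (ε / 2) := by
        gcongr
        · simp
        · exact (ENNReal.ofReal_lt_ofReal_iff (half_pos hε)).2 hlt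
    _ = ENNReal.ofReal ε := by
        rw [← ENNReal.ofReal_ofNat 2, ← ENNReal.ofReal_mul zero_le_two,
          mul_div_cancel₀ ε two_ne_zero]

theorem isACGStar_of_absolutelyContinuousOnInterval {p q : ℝ}
    (h : AbsolutelyContinuousOnInterval g p q) : IsACGStar g (uIcc p q) :=
  ⟨h.continuousOn, fun _ => uIcc p q, (iUnion_const _).symm, fun _ =>
    isACStar_of_absolutelyContinuousOnInterval h⟩

end ACStar

section ExtSup

variable {S : Set ℝ}

theorem le_extSup {t : ℝ} (ht : t ∈ S) : (t : EReal) ≤ extSup S :=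
  le_sSup (mem_image_of_mem _ ht)

theorem lt_extSup_iff {e : EReal} : e < extSup S ↔ ∃ t ∈ S, e < (t : EReal) := by
  simp only [extSup, lt_sSup_iff, exists_mem_image]

theorem extSup_ne_top_of_bddAbove (hS : BddAbove S) : extSup S ≠ ⊤ := by
  obtain ⟨M, hM⟩ := hS
  refine ((sSup_le ?_).trans_lt (EReal.coe_lt_top M)).ne
  exact forall_mem_image.2 fun t ht => EReal.coe_le_coe_iff.2 (hM ht)

theorem preimage_Ico_extSup_subset (hS : S.OrdConnected) {p : ℝ} (hp : p ∈ S) :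
    Real.toEReal ⁻¹' Ico ↑p (extSup S) ⊆ S := by
  rintro t ⟨hpt, hlt⟩
  obtain ⟨q, hq, htq⟩ := lt_extSup_iff.1 hlt
  exact hS.out hp hq ⟨EReal.coe_le_coe_iff.1 hpt, (EReal.coe_lt_coe_iff.1 htq).le⟩

theorem nontrivial_preimage_Ioo {l u : EReal} (h : l < u) :
    (Real.toEReal ⁻¹' Ioo l u).Nontrivial := by
  obtain ⟨s, hls, hsu⟩ := EReal.lt_iff_exists_real_btwn.1 h
  obtain ⟨t, hst, htu⟩ := EReal.lt_iff_exists_real_btwn.1 hsu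
  exact ⟨s, ⟨hls, hsu⟩, t, ⟨hls.trans hst, htu⟩, (EReal.coe_lt_coe_iff.1 hst).ne⟩

theorem extSup_preimage_Ioo {l u : EReal} (h : l < u) : extSup (Real.toEReal ⁻¹' Ioo l u) = u := by
  refine (sSup_le (forall_mem_image.2 fun t ht => ht.2.le)).antisymm ?_
  refine le_of_forall_lt fun e he => ?_
  obtain ⟨t, ht, htu⟩ := EReal.lt_iff_exists_real_btwn.1 (max_lt h he)
  exact lt_extSup_iff.2 ⟨t, ⟨(le_max_left l e).trans_lt ht, htu⟩, (le_max_right l e).trans_lt ht⟩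

theorem eventually_comap_nhdsLT_notMem {D : Set ℝ} (hcluster : ∀ t : ℝ, ¬ AccPt t (𝓟 D)) {e : EReal}
    (htop : e = ⊤ → BddAbove D) : ∀ᶠ t in comap Real.toEReal (𝓝[<] e), t ∉ D := by
  induction e with
  | bot => simp
  | coe r =>
    have hcomap : comap Real.toEReal (𝓝[<] (r : EReal)) = 𝓝[<] r := by
      rw [nhdsWithin, comap_inf, comap_principal, ← EReal.isEmbedding_coe.nhds_eq_comap]
      simp [nhdsWithin, preimage, Iio_def]
    have hacc := hcluster r
    rw [accPt_iff_frequently_nhdsNE, not_frequently] at hacc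
    exact hcomap ▸ hacc.filter_mono (nhdsWithin_mono r fun t ht => ne_of_lt ht)
  | top =>
    obtain ⟨M, hM⟩ := htop rfl
    have hgt : ∀ᶠ t in 𝓝[<] (⊤ : EReal), (M : EReal) < t :=
      nhdsWithin_le_nhds (Ioi_mem_nhds (EReal.coe_lt_top M))
    exact (tendsto_comap.eventually hgt).mono fun t ht htD =>
      (EReal.coe_lt_coe_iff.1 ht).not_ge (hM htD)

end ExtSup

section Solutions

variable {n : ℕ} {F : EuclideanSpace ℝ (Fin n) → ℝ → Set (EuclideanSpace ℝ (Fin n))}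
  {I J : Set ℝ} {x : ℝ → EuclideanSpace ℝ (Fin n)}

theorem isLAC_of_subsingleton (hI : I.Subsingleton) : IsLAC x I := by
  intro a b hab hsub
  have hIcc : (uIcc a b).Subsingleton := uIcc_of_le hab ▸ hI.anti hsub
  exact LipschitzOnWith.absolutelyContinuousOnInterval (K := 0) fun s hs t ht => by
    simp [hIcc hs ht]

theorem SatisfiesInclusion.mono (h : SatisfiesInclusion F I x) (hJI : J ⊆ I) :
    SatisfiesInclusion F J x := by
  filter_upwards [ae_restrict_of_ae_restrict_of_subset hJI h] with t ⟨v, hv, hderiv⟩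
  exact ⟨v, hv, hderiv.mono hJI⟩

theorem IsTimeInterval.mono (h : IsTimeInterval I) (hJI : J ⊆ I) (hJ : J.OrdConnected)
    (hne : J.Nonempty) : IsTimeInterval J :=
  ⟨hJ, hne, hJI.trans h.2.2⟩

theorem IsGeneralizedSolution.mono (h : IsGeneralizedSolution F I x) (hJI : J ⊆ I)
    (hJ : J.OrdConnected) (hne : J.Nonempty) : IsGeneralizedSolution F J x :=
  ⟨h.1.mono hJI hJ hne, h.2.1.mono hJI, h.2.2.mono hJI⟩

theorem IsClassicalSolution.isGeneralizedSolution_Icc (h : IsClassicalSolution F I x) {p q : ℝ}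
    (hp : p ∈ I) (hq : q ∈ I) (hpq : p ≤ q) : IsGeneralizedSolution F (Icc p q) x := by
  have hsub : Icc p q ⊆ I := h.1.1.out hp hq
  refine ⟨h.1.mono hsub ordConnected_Icc (nonempty_Icc.2 hpq), ?_, h.2.2.mono hsub⟩
  exact uIcc_of_le hpq ▸ isACGStar_of_absolutelyContinuousOnInterval (h.2.1 p q hpq hsub)

theorem LocallyBoundedOn.isBounded_biUnion {E : Set (EuclideanSpace ℝ (Fin n) × ℝ)}
    (hF : LocallyBoundedOn F E) {K : Set ℝ} (hK : IsCompact K) (hx : ContinuousOn x K)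
    (hKE : ∀ t ∈ K, (x t, t) ∈ E) : Bornology.IsBounded (⋃ t ∈ K, F (x t) t) := by
  refine hK.induction_on (p := fun K => Bornology.IsBounded (⋃ t ∈ K, F (x t) t)) (by simp)
    (fun s t hst ht => ht.subset (biUnion_subset_biUnion_left hst))
    (fun s t hs ht => by rw [biUnion_union]; exact hs.union ht) fun t ht => ?_
  obtain ⟨Q, hQ⟩ := hF _ (hKE t ht)
  have hlim : Tendsto (fun s => (x s, s)) (𝓝[K] t) (𝓝[E] (x t, t)) :=
    tendsto_nhdsWithin_of_tendsto_nhds_of_eventually_within _ ((hx.prodMk continuousOn_id) t ht)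
      (eventually_mem_nhdsWithin.mono hKE)
  refine ⟨_, hlim.eventually hQ, isBounded_iff_forall_norm_le.2 ⟨Q, fun v hv => ?_⟩⟩
  obtain ⟨s, hs, hvs⟩ := mem_iUnion₂.1 hv
  exact hs v hvs

theorem IsGeneralizedSolution.isClassicalSolution {D : Set ℝ}
    (hF : LocallyBoundedOn F (univ ×ˢ (Ici 0 \ D))) (h : IsGeneralizedSolution F I x)
    (hID : Disjoint I D) : IsClassicalSolution F I x := by
  obtain ⟨hI, hac, hincl⟩ := h
  refine ⟨hI, fun a b hab hsub => ?_, hincl⟩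
  have hbdd : Bornology.IsBounded (⋃ t ∈ Icc a b, F (x t) t) :=
    hF.isBounded_biUnion isCompact_Icc (hac.1.mono hsub) fun t ht =>
      ⟨mem_univ _, hI.2.2 (hsub ht), disjoint_left.1 hID (hsub ht)⟩
  obtain ⟨K, hK0, hK⟩ := hbdd.exists_pos_norm_le
  lift K to ℝ≥0 using hK0.le
  have hlip : LipschitzOnWith K x (Icc a b) := by
    refine (hac.mono hsub).lipschitzOnWith ordConnected_Icc ?_
    filter_upwards [hincl.mono hsub, ae_restrict_mem measurableSet_Icc] with t ⟨v, hv, hderiv⟩ ht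
    exact ⟨v, hK v (mem_biUnion ht hv), hderiv⟩
  exact (uIcc_of_le hab ▸ hlip).absolutelyContinuousOnInterval

theorem IsMaximalSolution.isMaximalSolution_classical
    (hx : IsMaximalSolution (IsGeneralizedSolution F) I x) (hJ : IsClassicalSolution F J x)
    (hJI : J ⊆ I) (hsup : extSup J = extSup I) :
    IsMaximalSolution (IsClassicalSolution F) J x := by
  refine ⟨hJ, ?_⟩
  rintro ⟨I', x', hx', ⟨p, hpI', hpJ⟩, hlt, heq⟩
  obtain ⟨q, hq, hIq⟩ := lt_extSup_iff.1 (hsup ▸ hlt)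
  have hpq : p ≤ q := (EReal.coe_lt_coe_iff.1 ((le_extSup (hJI hpJ)).trans_lt hIq)).le
  have hgen : IsGeneralizedSolution F (Icc p q) x' := hx'.isGeneralizedSolution_Icc hpI' hq hpq
  have hsub : Icc p q ⊆ I' := hx'.1.1.out hpI' hq
  refine hx.2 ⟨Icc p q, x', hgen, ⟨p, left_mem_Icc.2 hpq, hJI hpJ⟩,
    hIq.trans_le (le_extSup (right_mem_Icc.2 hpq)), ?_⟩
  rintro t ⟨htI, hpt, htq⟩
  rcases hpt.eq_or_lt with rfl | hpt
  · exact heq ⟨hpJ, hpI'⟩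
  have hIco : Ico p t ⊆ J := fun s hs =>
    preimage_Ico_extSup_subset hJ.1.1 hpJ ⟨EReal.coe_le_coe_iff.2 hs.1,
      hsup ▸ (EReal.coe_lt_coe_iff.2 hs.2).trans_le (le_extSup htI)⟩
  have htq' : Icc p t ⊆ Icc p q := Icc_subset_Icc_right htq
  have hEqOn : EqOn x x' (Ico p t) := fun s hs =>
    heq ⟨hIco hs, hsub (htq' (Ico_subset_Icc_self hs))⟩
  -- `t` may be missing from `J`, when it is the last time of `I`.
  exact hEqOn.of_subset_closure (hx.1.2.1.1.mono (hx.1.1.1.out (hJI hpJ) htI))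
    (hgen.2.1.1.mono htq') Ico_subset_Icc_self (closure_Ico hpt.ne).ge (right_mem_Icc.2 hpt.le)

end Solutions

theorem mainTheorem3_general {n : ℕ}
    {F : EuclideanSpace ℝ (Fin n) → ℝ → Set (EuclideanSpace ℝ (Fin n))} {D I : Set ℝ}
    {x : ℝ → EuclideanSpace ℝ (Fin n)} (hF : LocallyBoundedOn F (univ ×ˢ (Ici 0 \ D)))
    (hx : IsMaximalSolution (IsGeneralizedSolution F) I x)
    (hD : ∀ᶠ t in comap Real.toEReal (𝓝[<] extSup I), t ∉ D) :
    ∃ J : Set ℝ, J ⊆ I ∧ (I.Nontrivial → J.Nontrivial) ∧ extSup J = extSup I ∧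
      IsMaximalSolution (IsClassicalSolution F) J x := by
  rcases I.subsingleton_or_nontrivial with hsub | hnt
  · exact ⟨I, subset_rfl, id, rfl, hx.isMaximalSolution_classical
      ⟨hx.1.1, isLAC_of_subsingleton hsub, hx.1.2.2⟩ subset_rfl rfl⟩
  obtain ⟨p, hp, q, hq, hpq⟩ := hnt.exists_lt
  have hp_lt : (p : EReal) < extSup I := lt_extSup_iff.2 ⟨q, hq, EReal.coe_lt_coe_iff.2 hpq⟩
  obtain ⟨V, hV, hVD⟩ := mem_comap.1 hD
  obtain ⟨c, hc, hcV⟩ := (mem_nhdsLT_iff_exists_Ioo_subset' hp_lt).1 hV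
  have hlt : max (p : EReal) c < extSup I := max_lt hp_lt hc
  let J : Set ℝ := Real.toEReal ⁻¹' Ioo (max ↑p c) (extSup I)
  have hJI : J ⊆ I := fun t ht => preimage_Ico_extSup_subset hx.1.1.1 hp
    ⟨((le_max_left _ c).trans_lt ht.1).le, ht.2⟩
  have hJD : Disjoint J D := disjoint_left.2 fun t ht =>
    hVD (hcV ⟨(le_max_right _ c).trans_lt ht.1, ht.2⟩)
  have hJnt : J.Nontrivial := nontrivial_preimage_Ioo hlt
  have hJ : J.OrdConnected := ordConnected_Ioo.preimage_mono EReal.coe_strictMono.monotone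
  have hJsup : extSup J = extSup I := extSup_preimage_Ioo hlt
  exact ⟨J, hJI, fun _ => hJnt, hJsup, hx.isMaximalSolution_classical
    ((hx.1.mono hJI hJ hJnt.nonempty).isClassicalSolution hF hJD) hJI hJsup⟩

theorem mainTheorem3 {n : ℕ}
    (F : EuclideanSpace ℝ (Fin n) → ℝ → Set (EuclideanSpace ℝ (Fin n)))
    (D : Set ℝ) (hD : D ⊆ Ici 0)
    (hcluster : ∀ t : ℝ, ¬ AccPt t (𝓟 D))
    (hF : LocallyBoundedOn F (univ ×ˢ (Ici 0 \ D)))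
    (I : Set ℝ) (x : ℝ → EuclideanSpace ℝ (Fin n))
    (hx : IsMaximalSolution (IsGeneralizedSolution F) I x)
    (hfin : BddAbove I ∨ BddAbove D) :
    ∃ J : Set ℝ, J ⊆ I ∧ (I.Nontrivial → J.Nontrivial) ∧ extSup J = extSup I ∧
      IsMaximalSolution (IsClassicalSolution F) J x :=
  mainTheorem3_general hF hx <| eventually_comap_nhdsLT_notMem hcluster fun htop =>
    hfin.resolve_left fun hI => extSup_ne_top_of_bddAbove hI htop
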